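/- For $P=(x,y)\in\mathbb{C}^2$ write $d(P)=x^2+y^2$. A complex realisation of a graph $G=(V,E)$ is a map $p:V\to\mathbb{C}^2$; it is generic if the $2|V|$ coordinates of the points $p(v)$, $v\in V$, are algebraically independent over $\mathbb{Q}$. Two complex realisations $p,q$ of $G$ are equivalent if $d(p(u)-p(v))=d(q(u)-q(v))$ for all edges $uv\in E$, and congruent if $d(p(u)-p(v))=d(q(u)-q(v))$ for all $u,v\in V$. Let $c(G,p)$ be the number of congruence classes in the set of all complex realisations of $G$ that are equivalent to $p$; if $c(G,p)$ takes the same value for all generic complex realisations $p$ of $G$, this common value is denoted by $c(G)$. Let $P$ be the triangular prism, that is, the graph on six vertices consisting of two disjoint triangles joined by a perfect matching. Then $c(P)=12$: generic complex realisations of $P$ exist, and $c(P,p)=12$ for every generic complex realisation $p$ of $P$. -/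

import Mathlib

/-- The squared length `d(x, y) = x² + y²` of a vector of `ℂ²`
(a bilinear, not a Hermitian, expression). -/
def sqLen (P : Fin 2 → ℂ) : ℂ := P 0 ^ 2 + P 1 ^ 2

/-- A complex realisation of a graph with vertex set `V` is a map `V → ℂ²`. -/
abbrev Realisation (V : Type*) := V → Fin 2 → ℂ

namespace Realisation

variable {V : Type*}

/-- The family of all the coordinates of the points `p v` is algebraically independent over `ℚ`. -/
def IsGeneric (p : Realisation V) : Prop :=
  AlgebraicIndependent ℚ (fun x : V × Fin 2 => p x.1 x.2)

/-- `(G, p)` and `(G, q)` have the same squared edge lengths. -/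
def Equivalent (G : SimpleGraph V) (p q : Realisation V) : Prop :=
  ∀ u v : V, G.Adj u v → sqLen (p u - p v) = sqLen (q u - q v)

/-- All pairs of vertices have the same squared distance in `p` as in `q`. -/
def Congruent (p q : Realisation V) : Prop :=
  ∀ u v : V, sqLen (p u - p v) = sqLen (q u - q v)

/-- Congruence, as an equivalence relation on the set of all complex realisations of `G` that are
equivalent to `(G, p)`. -/
def congruenceSetoid (G : SimpleGraph V) (p : Realisation V) :
    Setoid {q : Realisation V // Equivalent G p q} where
  r q q' := Congruent q.1 q'.1
  iseqv :=
    { refl := fun _ _ _ => rfl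
      symm := fun h u v => (h u v).symm
      trans := fun h h' u v => (h u v).trans (h' u v) }

/-- `c(G, p)`: the number of congruence classes in the set of all complex realisations of `G`
that are equivalent to `(G, p)`, possibly `⊤`. -/
noncomputable def complexCount (G : SimpleGraph V) (p : Realisation V) : ℕ∞ :=
  ENat.card (Quotient (congruenceSetoid G p))

end Realisation

/-- `c(G) = n`: generic complex realisations of `G` exist, and each generic complex realisation
`(G, p)` has `c(G, p) = n`. -/
def HasComplexCount {V : Type*} (G : SimpleGraph V) (n : ℕ∞) : Prop :=
  (∃ p : Realisation V, p.IsGeneric) ∧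
    ∀ p : Realisation V, p.IsGeneric → p.complexCount G = n

/-- The triangular prism: the triangles `{0} × Fin 3` and `{1} × Fin 3`, joined by the perfect
matching formed by the edges `(0, a)(1, a)`. -/
def triangularPrism : SimpleGraph (Fin 2 × Fin 3) where
  Adj x y := (x.1 = y.1 ∧ x.2 ≠ y.2) ∨ (x.1 ≠ y.1 ∧ x.2 = y.2)
  symm := ⟨fun _ _ h => h.imp (fun h => ⟨h.1.symm, h.2.symm⟩) (fun h => ⟨h.1.symm, h.2.symm⟩)⟩
  loopless := ⟨fun _ h => h.elim (fun h => h.2 rfl) (fun h => h.1 rfl)⟩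

/-! In the isotropic coordinates `x ± iy` squared length is a product, rotations act by `(z, w) ↦
(xz, x⁻¹w)`, and reflections swap the two coordinates. Each congruence class has exactly one
representative whose first triangle is that of `p`, so the classes correspond to placements of the
second triangle with prescribed sides and rungs (`complexCount_triangularPrism`).

Such a placement is a translate of a rotated copy of the triangle or of its mirror image. For a
fixed rotation `x`, differences of the three rung equations are linear in the translation; Cramer's
rule solves them, and the remaining equation becomes a sextic in `x` (`encard_gluings`). Generically
both sextics are separable of degree 6 with nonzero constant term, which gives 6 + 6 = 12.

Separability is the nonvanishing of a resultant, so one integer sample reduced mod 7 settles it for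
each sextic (`Polynomial.Separable.of_map_specialization`). -/

/-! ### Separability and specialisation -/

open Polynomial in
theorem Polynomial.resultant_ne_zero_iff_isCoprime {K : Type*} [Field K] {f g : K[X]} (hf : f ≠ 0)
    {n : ℕ} (hn : g.natDegree ≤ n) : resultant f g f.natDegree n ≠ 0 ↔ IsCoprime f g := by
  obtain ⟨k, rfl⟩ := Nat.exists_eq_add_of_le hn
  rw [resultant_add_right_deg _ _ _ _ _ le_rfl]
  have h := resultant_eq_zero_iff (f := f) (g := g)
  simp only [ne_eq, mul_eq_zero, pow_eq_zero_iff', coeff_natDegree, leadingCoeff_eq_zero, hf, h]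
  simp

open Polynomial in
/-- Separability of a polynomial over a domain spreads from one specialisation which preserves the
degree to every faithful one. -/
theorem Polynomial.Separable.of_map_specialization {R K L : Type*} [CommRing R] [Field K] [Field L]
    {f : R[X]} {φ : R →+* K} (hφ : Function.Injective φ) (ψ : R →+* L)
    (hdeg : f.natDegree ≤ (f.map ψ).natDegree) (hsep : (f.map ψ).Separable) :
    (f.map φ).Separable ∧ (f.map φ).natDegree = (f.map ψ).natDegree := by
  have hd : (f.map ψ).natDegree = f.natDegree := le_antisymm natDegree_map_le hdeg
  have hdφ : (f.map φ).natDegree = f.natDegree := natDegree_map_eq_of_injective hφ f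
  have hψ0 : f.map ψ ≠ 0 := hsep.ne_zero
  have hf0 : f ≠ 0 := by rintro rfl; simp at hψ0
  have hφ0 : f.map φ ≠ 0 := (Polynomial.map_ne_zero_iff hφ).2 hf0
  refine ⟨?_, hdφ.trans hd.symm⟩
  -- The degree of the derivative can drop under `χ`, so it is given the formal degree
  -- `f.natDegree`: the resultant then commutes with `χ`, and the padding only costs powers of a
  -- nonzero leading coefficient.
  have hdeg' {F : Type _} [Field F] (χ : R →+* F) :
      (f.map χ).derivative.natDegree ≤ f.natDegree :=
    (natDegree_derivative_le _).trans ((Nat.sub_le _ _).trans natDegree_map_le)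
  have h1 := (resultant_ne_zero_iff_isCoprime hψ0 (hdeg' ψ)).2 hsep
  rw [hd, derivative_map, resultant_map_map] at h1
  refine (resultant_ne_zero_iff_isCoprime hφ0 (n := f.natDegree) ?_).1 ?_
  · exact (natDegree_derivative_le _).trans ((Nat.sub_le _ _).trans natDegree_map_le)
  rw [hdφ, derivative_map, resultant_map_map]
  intro h
  have := (map_eq_zero_iff φ hφ).1 h
  exact h1 (by rw [this, map_zero])

/-! ### Isotropic coordinates and generic realisations -/

/-- The isotropic coordinate `x + iy` of a realisation. -/
def Realisation.isoZ {V : Type*} (p : Realisation V) (v : V) : ℂ := p v 0 + Complex.I * p v 1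

/-- The isotropic coordinate `x - iy` of a realisation. -/
def Realisation.isoW {V : Type*} (p : Realisation V) (v : V) : ℂ := p v 0 - Complex.I * p v 1

/-- The realisation with given isotropic coordinates. -/
noncomputable def Realisation.ofIso {V : Type*} (Z W : V → ℂ) : Realisation V :=
  fun v => ![(Z v + W v) / 2, (Z v - W v) / (2 * Complex.I)]

@[simp]
theorem Realisation.isoZ_ofIso {V : Type*} (Z W : V → ℂ) : (ofIso Z W).isoZ = Z := by
  ext v
  simp only [isoZ, ofIso, Matrix.cons_val_zero, Matrix.cons_val_one]
  field_simp
  ring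

@[simp]
theorem Realisation.isoW_ofIso {V : Type*} (Z W : V → ℂ) : (ofIso Z W).isoW = W := by
  ext v
  simp only [isoW, ofIso, Matrix.cons_val_zero, Matrix.cons_val_one]
  field_simp
  ring

theorem Realisation.sqLen_sub {V : Type*} (p : Realisation V) (u v : V) :
    sqLen (p u - p v) = (p.isoZ u - p.isoZ v) * (p.isoW u - p.isoW v) := by
  simp only [sqLen, isoZ, isoW, Pi.sub_apply]
  linear_combination ((p u 1 - p v 1) ^ 2) * Complex.I_sq

/-- The isotropic coordinates of a generic realisation are algebraically independent. -/
theorem Realisation.IsGeneric.exists_injective {V : Type*} {p : Realisation V} (hp : p.IsGeneric) :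
    ∃ φ : MvPolynomial (V × Fin 2) ℤ →+* ℂ, Function.Injective φ ∧
      (∀ v, φ (.X (v, 0)) = p.isoZ v) ∧ ∀ v, φ (.X (v, 1)) = p.isoW v := by
  -- Independence passes to the algebraic closure of `ℚ`, which contains `i`; over it the change to
  -- isotropic coordinates `f` is a linear substitution undone by `g`.
  have hK : AlgebraicIndependent (algebraicClosure ℚ ℂ) (fun x : V × Fin 2 => p x.1 x.2) :=
    AlgebraicIndependent.algebraicClosure hp
  let I : algebraicClosure ℚ ℂ := ⟨Complex.I, by
    rw [mem_algebraicClosure_iff]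
    exact (IsIntegral.of_pow (n := 2) two_pos (by simpa using isIntegral_one.neg)).isAlgebraic⟩
  have hI : I * I = -1 := Subtype.ext Complex.I_mul_I
  let f : V × Fin 2 → MvPolynomial (V × Fin 2) (algebraicClosure ℚ ℂ) := fun x =>
    .X (x.1, 0) + .C (![I, -I] x.2) * .X (x.1, 1)
  let g : V × Fin 2 → MvPolynomial (V × Fin 2) (algebraicClosure ℚ ℂ) := fun x =>
    ![.C 2⁻¹ * (.X (x.1, 0) + .X (x.1, 1)), .C (-I / 2) * (.X (x.1, 0) - .X (x.1, 1))] x.2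
  have hfg : (MvPolynomial.aeval g).comp (MvPolynomial.aeval f) = AlgHom.id _ _ := by
    have h2 : 2 * (MvPolynomial.C 2⁻¹ : MvPolynomial (V × Fin 2) (algebraicClosure ℚ ℂ)) = 1 := by
      rw [← map_ofNat MvPolynomial.C 2, ← map_mul]
      norm_num
    have hI2 : (MvPolynomial.C I : MvPolynomial (V × Fin 2) (algebraicClosure ℚ ℂ)) *
        MvPolynomial.C (-I / 2) = MvPolynomial.C 2⁻¹ := by
      rw [← map_mul, ← mul_div_assoc, mul_neg, hI, neg_neg, one_div]
    ext ⟨v, i⟩ : 1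
    fin_cases i
    · simp [f, g, MvPolynomial.algebraMap_eq]
      linear_combination (.X (v, 0) - .X (v, 1)) * hI2 + .X (v, 0) * h2
    · simp [f, g, MvPolynomial.algebraMap_eq]
      linear_combination (.X (v, 1) - .X (v, 0)) * hI2 + .X (v, 1) * h2
  have hf : AlgebraicIndependent (algebraicClosure ℚ ℂ) f := by
    intro a b hab
    have := congrArg (MvPolynomial.aeval g) hab
    rwa [← AlgHom.comp_apply, ← AlgHom.comp_apply, hfg] at this
  have h := (hK.aeval_of_algebraicIndependent hf).restrictScalars (R := ℤ)
    (FaithfulSMul.algebraMap_injective _ _)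
  refine ⟨(MvPolynomial.aeval _).toRingHom, h, fun v => ?_, fun v => ?_⟩
  · simp [f, Realisation.isoZ, I]
  · simp [f, Realisation.isoW, I, sub_eq_add_neg]

/-- By cardinality a transcendence basis of `ℂ` over `ℚ` is infinite, so countably many coordinates
can be injected into it. -/
theorem Realisation.exists_isGeneric {V : Type*} [Countable V] : ∃ p : Realisation V, p.IsGeneric := by
  obtain ⟨s, hs⟩ := exists_isTranscendenceBasis ℚ ℂ
  have hc : Cardinal.mk ℂ = Cardinal.mk s := by
    apply IsAlgClosed.cardinal_eq_cardinal_transcendence_basis_of_aleph0_lt' _ hs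
    · simp
    · simpa using Cardinal.aleph0_lt_continuum
  have : Infinite s := by
    rw [Cardinal.infinite_iff, ← hc]; simpa using Cardinal.aleph0_lt_continuum.le
  obtain ⟨e, he⟩ := exists_injective_nat (V × Fin 2)
  let j := Infinite.natEmbedding s
  refine ⟨fun v i => j (e (v, i)), ?_⟩
  exact hs.1.comp (fun x => j (e x)) (j.injective.comp he)

/-! ### The gluing sextic -/

open Polynomial in
/-- The polynomial whose nonzero roots `x` are the `x` such that the triangle `(z, w)`, in isotropic
coordinates, has an image under a rotation by `x` and a translation whose vertices
are at the squared distances `l` from the vertices of the triangle `(α, β)`. -/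
noncomputable def gluingPoly {R : Type*} [CommRing R] (α β z w l : Fin 3 → R) : R[X] :=
  -- With `(s, t)` the displacement of vertex 0 from `(α 0, β 0)`, rung equation `i` minus rung
  -- equation 0, times `x`, reads `s * B i + x * t * A i = S i`. The sextic is `s * t = l 0` after
  -- Cramer's rule, with denominators cleared.
  let A i := C (z i - z 0) * X - C (α i - α 0)
  let B i := C (w i - w 0) - C (β i - β 0) * X
  let S i := C ((z i - z 0) * (β i - β 0)) * X ^ 2
    + C (l i - l 0 - (z i - z 0) * (w i - w 0) - (α i - α 0) * (β i - β 0)) * X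
    + C ((w i - w 0) * (α i - α 0))
  (S 1 * B 2 - S 2 * B 1) * (A 1 * S 2 - A 2 * S 1) - C (l 0) * X * (A 1 * B 2 - A 2 * B 1) ^ 2

open Polynomial in
theorem map_gluingPoly {R S : Type*} [CommRing R] [CommRing S] (φ : R →+* S)
    (α β z w l : Fin 3 → R) : (gluingPoly α β z w l).map φ =
      gluingPoly (φ ∘ α) (φ ∘ β) (φ ∘ z) (φ ∘ w) (φ ∘ l) := by
  simp [gluingPoly]

theorem natDegree_gluingPoly_le {R : Type*} [CommRing R] (α β z w l : Fin 3 → R) :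
    (gluingPoly α β z w l).natDegree ≤ 6 := by
  simp only [gluingPoly]
  compute_degree

/-- The squared distances between corresponding vertices of two triangles, in isotropic
coordinates. -/
def rungs {R : Type*} [CommRing R] (α β z w : Fin 3 → R) (i : Fin 3) : R :=
  (z i - α i) * (w i - β i)

/-- A product of expressions in the isotropic coordinates of two triangles which do not vanish when
the triangles are in general position. -/
def nondegeneracy {R : Type*} [CommRing R] (α β z w : Fin 3 → R) : R :=
  let e (u v : Fin 3 → R) := (u 1 - u 0) * (v 2 - v 0) - (u 2 - u 0) * (v 1 - v 0)
  let d (u : Fin 3 → R) := (u 1 - u 0) * (u 2 - u 0) * (u 2 - u 1)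
  -- The factors `d` keep side lengths and the constant term of the sextic nonzero. `e α β` and `e z
  -- w` are signed areas up to a constant; `e α z` and `e β w` prevent `A 1, A 2` or `B 1, B 2` from
  -- vanishing together, and the last two factors do this for the mirror image.
  d α * d β * d z * d w * (e α β * e z w * e α z * e β w * e α w * e β z)

theorem map_nondegeneracy {R S : Type*} [CommRing R] [CommRing S] (φ : R →+* S)
    (α β z w : Fin 3 → R) : φ (nondegeneracy α β z w) =
      nondegeneracy (φ ∘ α) (φ ∘ β) (φ ∘ z) (φ ∘ w) := by
  simp [nondegeneracy]

theorem map_comp_rungs {R S : Type*} [CommRing R] [CommRing S] (φ : R →+* S)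
    (α β z w : Fin 3 → R) : φ ∘ rungs α β z w = rungs (φ ∘ α) (φ ∘ β) (φ ∘ z) (φ ∘ w) := by
  ext; simp [rungs]

/-! ### Sample triangles modulo 7 -/

open Polynomial in
theorem separable_map_zmod_seven {f : ℤ[X]} {a : ℤ} (ha : (a : ZMod 7) ≠ 0) {g : ℤ[X]}
    (hf : f = C a * (X ^ 6 - 1) + 7 * g) :
    (f.map (Int.castRingHom (ZMod 7))).natDegree = 6 ∧
      (f.map (Int.castRingHom (ZMod 7))).Separable := by
  have h6 : ((6 : ℕ) : ZMod 7) ≠ 0 := by decide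
  have : Fact (Nat.Prime 7) := ⟨by norm_num⟩
  have h7 : (7 : (ZMod 7)[X]) = 0 := by exact_mod_cast CharP.cast_eq_zero (ZMod 7)[X] 7
  have h : f.map (Int.castRingHom (ZMod 7)) = C (a : ZMod 7) * (X ^ 6 - C 1) := by
    simp [hf, Polynomial.map_ofNat, h7]
  rw [h, natDegree_C_mul ha, natDegree_X_pow_sub_C]
  refine ⟨rfl, Separable.unit_mul (isUnit_C.2 (IsUnit.mk0 _ ha)) ?_⟩
  exact separable_X_pow_sub_C 1 h6 one_ne_zero

-- At this sample the sextic is, mod 7, a nonzero multiple of `X ^ 6 - 1`, whose roots are the six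
-- nonzero residues.
open Polynomial in
theorem gluingPoly_witness :
    gluingPoly (R := ℤ) ![0, 6, 5] ![0, 4, 2] ![0, 6, 4] ![1, 3, 4]
      (rungs ![0, 6, 5] ![0, 4, 2] ![0, 6, 4] ![1, 3, 4]) =
    C 5 * (X ^ 6 - 1) + 7 * (109 * X ^ 6 - 384 * X ^ 5 + 480 * X ^ 4 - 192 * X ^ 3 - 96 * X ^ 2
      + 108 * X - 25) := by
  simp [gluingPoly, rungs]
  ring

-- For the mirror image `z` and `w` are exchanged in the sextic but not in the rungs. Each sextic
-- may use its own sample.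
open Polynomial in
theorem gluingPoly_swap_witness :
    gluingPoly (R := ℤ) ![0, 2, 3] ![0, 1, 3] ![5, 1, 4] ![0, 6, 3]
      (rungs ![0, 2, 3] ![0, 1, 3] ![0, 6, 3] ![5, 1, 4]) =
    C 2 * (X ^ 6 - 1) + 7 * (10 * X ^ 6 - 24 * X ^ 5 - 222 * X ^ 4 - 78 * X ^ 3 + 306 * X ^ 2
      + 54 * X - 46) := by
  simp [gluingPoly, rungs]
  ring

/-! ### Counting gluings by roots of the sextic -/

-- Keeps the Cramer determinants `P`, `Q`, `D` opaque as polynomials, retaining only their values.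
open Polynomial in
theorem gluingPoly_decomposition {R : Type*} [CommRing R] (α β z w l : Fin 3 → R) :
    ∃ P Q D : R[X], gluingPoly α β z w l = P * Q - C (l 0) * X * D ^ 2 ∧ ∀ x : R,
      ∃ A B S : Fin 3 → R,
        (∀ i, A i = (z i - z 0) * x - (α i - α 0) ∧ B i = w i - w 0 - (β i - β 0) * x ∧
          S i = (z i - z 0) * (β i - β 0) * x ^ 2 + (l i - l 0 - (z i - z 0) * (w i - w 0)
            - (α i - α 0) * (β i - β 0)) * x + (w i - w 0) * (α i - α 0)) ∧
        P.eval x = S 1 * B 2 - S 2 * B 1 ∧ Q.eval x = A 1 * S 2 - A 2 * S 1 ∧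
        D.eval x = A 1 * B 2 - A 2 * B 1 :=
  ⟨_, _, _, rfl, fun _ => ⟨_, _, _, fun _ => ⟨rfl, rfl, rfl⟩, by simp, by simp, by simp⟩⟩

/-- The rotations `x.1` and translations that send the triangle `(z, w)` to a triangle whose
vertices are at the squared distances `l` from the vertices of `(α, β)`. -/
def gluings (α β z w l : Fin 3 → ℂ) : Set (ℂ × ℂ × ℂ) :=
  {x | x.1 ≠ 0 ∧ ∀ i, (x.2.1 + x.1 * (z i - z 0) - α i) *
    (x.2.2 + x.1⁻¹ * (w i - w 0) - β i) = l i}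

theorem mul_eq_iff_of_mul_eq {s t x a b z w l l₀ : ℂ} (hx : x ≠ 0) (h : s * t = l₀) :
    (s + x * z - a) * (t + x⁻¹ * w - b) = l ↔
      s * (w - b * x) + x * t * (z * x - a) =
        z * b * x ^ 2 + (l - l₀ - z * w - a * b) * x + w * a := by
  subst h
  constructor
  · rintro rfl
    field_simp
    ring
  · intro h
    apply mul_left_cancel₀ hx
    field_simp
    linear_combination h

open Polynomial in
theorem encard_gluings {α β z w l : Fin 3 → ℂ} (hnd : nondegeneracy α β z w ≠ 0)
    (hsep : (gluingPoly α β z w l).Separable) :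
    (gluings α β z w l).encard = (gluingPoly α β z w l).natDegree := by
  obtain ⟨P, Q, D, hG, hev⟩ := gluingPoly_decomposition α β z w l
  simp only [nondegeneracy, ne_eq, mul_eq_zero, not_or] at hnd
  have heval (x : ℂ) : (gluingPoly α β z w l).eval x =
      P.eval x * Q.eval x - l 0 * x * D.eval x ^ 2 := by simp [hG]
  -- Since `A i * P + B i * Q = S i * D`, a root with `D = 0` would have `P = Q = 0`, hence be a
  -- double root of `P * Q - l 0 * X * D ^ 2`.
  have hroot (x : ℂ) : (gluingPoly α β z w l).eval x = 0 → D.eval x ≠ 0 := by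
    intro h0 hD0
    obtain ⟨A, B, S, hABS, hP, hQ, hD⟩ := hev x
    rw [heval, hD0] at h0
    have h0' : P.eval x * Q.eval x = 0 := by linear_combination h0
    have h1 : A 1 * P.eval x + B 1 * Q.eval x = 0 := by
      rw [hP, hQ]; linear_combination S 1 * hD0 - S 1 * hD
    have h2 : A 2 * P.eval x + B 2 * Q.eval x = 0 := by
      rw [hP, hQ]; linear_combination S 2 * hD0 - S 2 * hD
    have hPQ : P.eval x = 0 ∧ Q.eval x = 0 := by
      by_cases hP0 : P.eval x = 0
      · refine ⟨hP0, by_contra fun hQ0 => ?_⟩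
        have hB1 : B 1 = 0 := by simpa [hP0, hQ0] using h1
        have hB2 : B 2 = 0 := by simpa [hP0, hQ0] using h2
        rw [(hABS _).2.1] at hB1 hB2
        grind
      · exfalso
        have hQ0 : Q.eval x = 0 := (mul_eq_zero.1 h0').resolve_left hP0
        have hA1 : A 1 = 0 := by simpa [hP0, hQ0] using h1
        have hA2 : A 2 = 0 := by simpa [hP0, hQ0] using h2
        rw [(hABS _).1] at hA1 hA2
        grind
    have hder : (gluingPoly α β z w l).derivative.eval x = 0 := by
      simp [hG, hPQ.1, hPQ.2, hD0, derivative_pow]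
    exact hsep.eval₂_derivative_ne_zero (RingHom.id ℂ) (x := x)
      (by simp [heval, hD0, hPQ.1]) (by simpa using hder)
  have key : ∀ x s t : ℂ, x ≠ 0 → ((x, s, t) ∈ gluings α β z w l ↔
      (t - β 0) * x * D.eval x = P.eval x ∧ (s - α 0) * D.eval x = Q.eval x ∧
        (gluingPoly α β z w l).eval x = 0 ∧ D.eval x ≠ 0) := by
    intro x s t hx
    obtain ⟨A, B, S, hABS, hP, hQ, hD⟩ := hev x
    have hlin (hst : (s - α 0) * (t - β 0) = l 0) (i : Fin 3) :
        (s + x * (z i - z 0) - α i) * (t + x⁻¹ * (w i - w 0) - β i) = l i ↔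
          (s - α 0) * B i + x * (t - β 0) * A i = S i := by
      rw [(hABS i).1, (hABS i).2.1, (hABS i).2.2, ← mul_eq_iff_of_mul_eq hx hst]
      ring_nf
    constructor
    · rintro ⟨-, h⟩
      have h0 : (s - α 0) * (t - β 0) = l 0 := by simpa using h 0
      have h1 := (hlin h0 1).1 (h 1)
      have h2 := (hlin h0 2).1 (h 2)
      have e1 : (t - β 0) * x * D.eval x = P.eval x := by
        rw [hP, hD, ← h1, ← h2]; ring
      have e2 : (s - α 0) * D.eval x = Q.eval x := by
        rw [hQ, hD, ← h1, ← h2]; ring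
      have e3 : (gluingPoly α β z w l).eval x = 0 := by
        rw [heval, ← e1, ← e2, ← h0]; ring
      exact ⟨e1, e2, e3, hroot x e3⟩
    · rintro ⟨e1, e2, e3, hD0⟩
      refine ⟨hx, ?_⟩
      have h0 : (s - α 0) * (t - β 0) = l 0 := by
        rw [heval, ← e1, ← e2] at e3
        apply mul_right_cancel₀ (mul_ne_zero hx (pow_ne_zero 2 hD0))
        linear_combination e3
      have h1 : (s - α 0) * B 1 + x * (t - β 0) * A 1 = S 1 := by
        apply mul_right_cancel₀ hD0
        linear_combination B 1 * e2 + A 1 * e1 + B 1 * hQ + A 1 * hP - S 1 * hD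
      have h2 : (s - α 0) * B 2 + x * (t - β 0) * A 2 = S 2 := by
        apply mul_right_cancel₀ hD0
        linear_combination B 2 * e2 + A 2 * e1 + B 2 * hQ + A 2 * hP - S 2 * hD
      intro i
      fin_cases i
      · simpa using h0
      · exact (hlin h0 1).2 h1
      · exact (hlin h0 2).2 h2
  have hinj : Set.InjOn Prod.fst (gluings α β z w l) := by
    rintro ⟨x, s, t⟩ h ⟨x', s', t'⟩ h' (rfl : x = x')
    have hx : x ≠ 0 := h.1
    obtain ⟨e1, e2, -, hD0⟩ := (key x s t hx).1 h
    obtain ⟨e1', e2', -⟩ := (key x s' t' hx).1 h'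
    have hs := mul_right_cancel₀ hD0 (e2.trans e2'.symm)
    have ht := mul_right_cancel₀ hx (mul_right_cancel₀ hD0 (e1.trans e1'.symm))
    rw [sub_left_inj] at hs ht
    rw [hs, ht]
  have himage : Prod.fst '' gluings α β z w l = (gluingPoly α β z w l).roots.toFinset := by
    ext x
    simp only [Set.mem_image, Finset.mem_coe, Multiset.mem_toFinset, mem_roots hsep.ne_zero,
      IsRoot.def]
    constructor
    · rintro ⟨⟨x, s, t⟩, h, rfl⟩
      exact ((key x s t h.1).1 h).2.2.1
    · intro h
      have hx : x ≠ 0 := by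
        rintro rfl
        simp only [gluingPoly, eval_sub, eval_mul, eval_add, eval_C, eval_X, eval_pow, ne_eq,
          OfNat.ofNat_ne_zero, not_false_eq_true, zero_pow, mul_zero, zero_mul, zero_add, zero_sub,
          sub_zero] at h
        -- This product is the constant term of the sextic.
        have h' : (w 1 - w 0) * (w 2 - w 0) * (w 2 - w 1) *
            ((α 1 - α 0) * (α 2 - α 0) * (α 2 - α 1)) = 0 := by linear_combination h
        simp only [mul_eq_zero] at h'
        tauto
      have hD0 := hroot x h
      exact ⟨(x, Q.eval x / D.eval x + α 0, P.eval x / (x * D.eval x) + β 0),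
        (key x _ _ hx).2 ⟨by field_simp; ring, by field_simp; ring, h, hD0⟩, rfl⟩
  rw [← hinj.encard_image, himage, Set.encard_coe_eq_coe_finsetCard,
    Multiset.toFinset_card_of_nodup (nodup_roots hsep),
    splits_iff_card_roots.1 (IsAlgClosed.splits _)]

/-! ### Placements of the second triangle -/

/-- Two triangles with the same squared side lengths differ by a rotation or a reflection. -/
theorem exists_rotation_of_sides_eq {u v u' v' : Fin 3 → ℂ}
    (h1 : (u 1 - u 0) * (v 1 - v 0) ≠ 0) (h2 : (u 2 - u 0) * (v 2 - v 0) ≠ 0)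
    (h : ∀ i j, (u' i - u' j) * (v' i - v' j) = (u i - u j) * (v i - v j)) :
    ∃ x : ℂ, x ≠ 0 ∧
      ((∀ i, u' i - u' 0 = x * (u i - u 0) ∧ v' i - v' 0 = x⁻¹ * (v i - v 0)) ∨
        ∀ i, u' i - u' 0 = x * (v i - v 0) ∧ v' i - v' 0 = x⁻¹ * (u i - u 0)) := by
  have aux : ∀ {a₁ a₂ b₁ b₂ c₁ c₂ d₁ d₂ : ℂ}, a₁ * b₁ ≠ 0 → a₂ * b₂ ≠ 0 → c₁ * d₁ = a₁ * b₁ →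
      c₂ * d₂ = a₂ * b₂ → c₁ * d₂ = a₁ * b₂ → ∃ x : ℂ, x ≠ 0 ∧ c₁ = x * a₁ ∧ d₁ = x⁻¹ * b₁ ∧
        c₂ = x * a₂ ∧ d₂ = x⁻¹ * b₂ := by
    intro a₁ a₂ b₁ b₂ c₁ c₂ d₁ d₂ ha hb e1 e2 e3
    have hc₁ : c₁ ≠ 0 := by rintro rfl; simp [← e1] at ha
    have hd₂ : d₂ ≠ 0 := by rintro rfl; simp [← e2] at hb
    simp only [ne_eq, mul_eq_zero, not_or] at ha hb
    obtain ⟨ha₁, hb₁⟩ := ha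
    obtain ⟨ha₂, hb₂⟩ := hb
    refine ⟨c₁ / a₁, div_ne_zero hc₁ ha₁, by field_simp, ?_, ?_, ?_⟩
    · rw [inv_div]; field_simp; linear_combination e1
    · field_simp
      apply mul_right_cancel₀ hd₂
      linear_combination a₁ * e2 - a₂ * e3
    · rw [inv_div]; field_simp; linear_combination e3
  have e1 := h 1 0
  have e2 := h 2 0
  have e3 := h 2 1
  -- The cross products `(u' 1 - u' 0) * (v' 2 - v' 0)` and `(u' 2 - u' 0) * (v' 1 - v' 0)` have the
  -- same sum and product as their unprimed analogues, so they are the roots of the same quadratic.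
  have hprod : ((u' 1 - u' 0) * (v' 2 - v' 0) - (u 1 - u 0) * (v 2 - v 0)) *
      ((u' 1 - u' 0) * (v' 2 - v' 0) - (v 1 - v 0) * (u 2 - u 0)) = 0 := by
    linear_combination (u' 1 - u' 0) * (v' 2 - v' 0) * (e1 + e2 - e3) -
      (u' 2 - u' 0) * (v' 2 - v' 0) * e1 - (u 1 - u 0) * (v 1 - v 0) * e2
  have all {P : Fin 3 → Prop} (h0 : P 0) (h1 : P 1) (h2 : P 2) (i : Fin 3) : P i := by
    fin_cases i <;> assumption
  rcases mul_eq_zero.1 hprod with hp | hp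
  · obtain ⟨x, hx, r1, r2, r3, r4⟩ := aux h1 h2 e1 e2 (sub_eq_zero.1 hp)
    exact ⟨x, hx, .inl (all (by simp) ⟨r1, r2⟩ ⟨r3, r4⟩)⟩
  · rw [mul_comm] at h1 h2
    rw [mul_comm (u 1 - u 0)] at e1
    rw [mul_comm (u 2 - u 0)] at e2
    obtain ⟨x, hx, r1, r2, r3, r4⟩ := aux h1 h2 e1 e2 (sub_eq_zero.1 hp)
    exact ⟨x, hx, .inr (all (by simp) ⟨r1, r2⟩ ⟨r3, r4⟩)⟩

/-- The triangles with the same squared side lengths as `(z, w)` whose vertices are at the squared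
distances `l` from the vertices of `(α, β)`. -/
def attachments (α β z w l : Fin 3 → ℂ) : Set ((Fin 3 → ℂ) × (Fin 3 → ℂ)) :=
  {x | (∀ i j, (x.1 i - x.1 j) * (x.2 i - x.2 j) = (z i - z j) * (w i - w j)) ∧
    ∀ i, (x.1 i - α i) * (x.2 i - β i) = l i}

/-- The image of a triangle under a rotation and a translation. -/
noncomputable def moveTriangle (z w : Fin 3 → ℂ) (x : ℂ × ℂ × ℂ) : (Fin 3 → ℂ) × (Fin 3 → ℂ) :=
  (fun i => x.2.1 + x.1 * (z i - z 0), fun i => x.2.2 + x.1⁻¹ * (w i - w 0))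

theorem nondegeneracy_swap {R : Type*} [CommRing R] (α β z w : Fin 3 → R) :
    nondegeneracy α β w z = -nondegeneracy α β z w := by
  simp only [nondegeneracy]
  rw [show (w 1 - w 0) * (z 2 - z 0) - (w 2 - w 0) * (z 1 - z 0) =
    -((z 1 - z 0) * (w 2 - w 0) - (z 2 - z 0) * (w 1 - w 0)) by ring]
  simp only [mul_neg, neg_mul]
  congr 1
  ac_rfl

theorem attachments_eq_union {α β z w : Fin 3 → ℂ} (l : Fin 3 → ℂ)
    (hnd : nondegeneracy α β z w ≠ 0) :
    attachments α β z w l =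
      moveTriangle z w '' gluings α β z w l ∪ moveTriangle w z '' gluings α β w z l := by
  simp only [nondegeneracy, ne_eq, mul_eq_zero, not_or] at hnd
  ext ⟨u, v⟩
  simp only [Set.mem_union, Set.mem_image]
  constructor
  · rintro ⟨h, hl⟩
    obtain ⟨x, hx, hr | hr⟩ := exists_rotation_of_sides_eq (u := z) (v := w)
      (mul_ne_zero (by tauto) (by tauto)) (mul_ne_zero (by tauto) (by tauto)) h
    · refine .inl ⟨(x, u 0, v 0), ⟨hx, fun i => ?_⟩, ?_⟩
      · simp only [← (hr i).1, ← (hr i).2, add_sub_cancel, hl i]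
      · simp only [moveTriangle, ← (hr _).1, ← (hr _).2, add_sub_cancel]
    · refine .inr ⟨(x, u 0, v 0), ⟨hx, fun i => ?_⟩, ?_⟩
      · simp only [← (hr i).1, ← (hr i).2, add_sub_cancel, hl i]
      · simp only [moveTriangle, ← (hr _).1, ← (hr _).2, add_sub_cancel]
  · rintro (⟨⟨x, s, t⟩, ⟨hx, h⟩, he⟩ | ⟨⟨x, s, t⟩, ⟨hx, h⟩, he⟩) <;>
    · simp only [moveTriangle, Prod.mk.injEq] at he hx h
      obtain ⟨rfl, rfl⟩ := he
      refine ⟨fun i j => ?_, h⟩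
      field_simp
      ring

theorem moveTriangle_injective {z w : Fin 3 → ℂ} (hz : z 1 - z 0 ≠ 0) :
    Function.Injective (moveTriangle z w) := by
  rintro ⟨x, s, t⟩ ⟨x', s', t'⟩ h
  simp only [moveTriangle, Prod.mk.injEq] at h
  have hs := congrFun h.1 0
  have ht := congrFun h.2 0
  have hx := congrFun h.1 1
  simp only [sub_self, mul_zero, add_zero] at hs ht
  subst hs ht
  rw [add_right_inj] at hx
  rw [mul_right_cancel₀ hz hx]

theorem encard_attachments {α β z w l : Fin 3 → ℂ} (hnd : nondegeneracy α β z w ≠ 0)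
    (h : (gluingPoly α β z w l).Separable) (h' : (gluingPoly α β w z l).Separable) :
    (attachments α β z w l).encard =
      (gluingPoly α β z w l).natDegree + (gluingPoly α β w z l).natDegree := by
  have hnd' : nondegeneracy α β w z ≠ 0 := by rwa [nondegeneracy_swap, neg_ne_zero]
  rw [attachments_eq_union l hnd, Set.encard_union_eq, Function.Injective.encard_image,
    Function.Injective.encard_image, encard_gluings hnd h, encard_gluings hnd' h']
  all_goals simp only [nondegeneracy, ne_eq, mul_eq_zero, not_or] at hnd
  · exact moveTriangle_injective (by tauto)
  · exact moveTriangle_injective (by tauto)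
  · rw [Set.disjoint_left]
    rintro _ ⟨⟨x, s, t⟩, ⟨hx, -⟩, rfl⟩ ⟨⟨x', s', t'⟩, ⟨hx', -⟩, he⟩
    simp only [moveTriangle, Prod.mk.injEq] at he hx hx'
    have e1 (i : Fin 3) : x' * (w i - w 0) = x * (z i - z 0) := by
      linear_combination congrFun he.1 i - congrFun he.1 0
    have e2 (i : Fin 3) : x'⁻¹ * (z i - z 0) = x⁻¹ * (w i - w 0) := by
      linear_combination congrFun he.2 i - congrFun he.2 0
    -- Rotations preserve the signed area and swapping the coordinates negates it, so a common image
    -- would force area zero.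
    have harea : (z 1 - z 0) * (w 2 - w 0) - (z 2 - z 0) * (w 1 - w 0) ≠ 0 := by tauto
    have hpos := mul_inv_cancel₀ hx
    have hneg := mul_inv_cancel₀ hx'
    apply harea
    have : (x * x⁻¹) * ((z 1 - z 0) * (w 2 - w 0) - (z 2 - z 0) * (w 1 - w 0)) =
        (x' * x'⁻¹) * ((w 1 - w 0) * (z 2 - z 0) - (w 2 - w 0) * (z 1 - z 0)) := by
      linear_combination -x⁻¹ * (w 2 - w 0) * e1 1 + x⁻¹ * (w 1 - w 0) * e1 2
        - x' * (w 1 - w 0) * e2 2 + x' * (w 2 - w 0) * e2 1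
    rw [hpos, hneg] at this
    linear_combination this / 2

/-! ### Congruence classes as placements -/

/-- A point is determined by its squared distances to the vertices of a nondegenerate triangle. -/
theorem eq_of_sqDist_eq {α β : Fin 3 → ℂ}
    (hαβ : (α 1 - α 0) * (β 2 - β 0) - (α 2 - α 0) * (β 1 - β 0) ≠ 0) {u v u' v' : ℂ}
    (h : ∀ i, (u - α i) * (v - β i) = (u' - α i) * (v' - β i)) : u = u' ∧ v = v' := by
  have e1 : (u - u') * (β 1 - β 0) + (v - v') * (α 1 - α 0) = 0 := by
    linear_combination h 0 - h 1
  have e2 : (u - u') * (β 2 - β 0) + (v - v') * (α 2 - α 0) = 0 := by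
    linear_combination h 0 - h 2
  constructor
  · apply mul_left_cancel₀ hαβ
    linear_combination (α 1 - α 0) * e2 - (α 2 - α 0) * e1
  · apply mul_left_cancel₀ hαβ
    linear_combination (β 2 - β 0) * e1 - (β 1 - β 0) * e2

theorem triangularPrism_equivalent_iff {p q : Realisation (Fin 2 × Fin 3)} :
    p.Equivalent triangularPrism q ↔
      (∀ a i j, (p.isoZ (a, i) - p.isoZ (a, j)) * (p.isoW (a, i) - p.isoW (a, j)) =
        (q.isoZ (a, i) - q.isoZ (a, j)) * (q.isoW (a, i) - q.isoW (a, j))) ∧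
      ∀ i, (p.isoZ (1, i) - p.isoZ (0, i)) * (p.isoW (1, i) - p.isoW (0, i)) =
        (q.isoZ (1, i) - q.isoZ (0, i)) * (q.isoW (1, i) - q.isoW (0, i)) := by
  simp only [Realisation.Equivalent, Realisation.sqLen_sub, triangularPrism]
  constructor
  · intro h
    refine ⟨fun a i j => ?_, fun i => h _ _ (.inr ⟨by simp, rfl⟩)⟩
    by_cases hij : i = j
    · simp [hij]
    · exact h _ _ (.inl ⟨rfl, hij⟩)
  · rintro ⟨h1, h2⟩ ⟨a, i⟩ ⟨b, j⟩ (⟨h, -⟩ | ⟨hab, h⟩)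
    · obtain rfl : a = b := h
      exact h1 a i j
    · obtain rfl : i = j := h
      have := h2 i
      fin_cases a <;> fin_cases b
      · exact absurd rfl hab
      · simp only [Fin.zero_eta, Fin.mk_one]
        linear_combination this
      · exact this
      · exact absurd rfl hab

theorem complexCount_triangularPrism {p : Realisation (Fin 2 × Fin 3)} {α β z w : Fin 3 → ℂ}
    (hα : ∀ i, p.isoZ (0, i) = α i) (hβ : ∀ i, p.isoW (0, i) = β i)
    (hz : ∀ i, p.isoZ (1, i) = z i) (hw : ∀ i, p.isoW (1, i) = w i)
    (hnd : nondegeneracy α β z w ≠ 0) :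
    p.complexCount triangularPrism = (attachments α β z w (rungs α β z w)).encard := by
  simp only [nondegeneracy, ne_eq, mul_eq_zero, not_or] at hnd
  let r (x : (Fin 3 → ℂ) × (Fin 3 → ℂ)) : Realisation (Fin 2 × Fin 3) :=
    .ofIso (fun v => ![α, x.1] v.1 v.2) (fun v => ![β, x.2] v.1 v.2)
  have hr (x) (hx : x ∈ attachments α β z w (rungs α β z w)) :
      p.Equivalent triangularPrism (r x) := by
    rw [triangularPrism_equivalent_iff]
    refine ⟨fun a i j => ?_, fun i => ?_⟩
    · fin_cases a
      · simp [r, hα, hβ]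
      · simp [r, hz, hw, hx.1]
    · simp [r, hz, hw, hα, hβ, hx.2, rungs]
  let f (x : attachments α β z w (rungs α β z w)) :
      Quotient (Realisation.congruenceSetoid triangularPrism p) := ⟦⟨r x.1, hr x.1 x.2⟩⟧
  rw [Realisation.complexCount, Set.encard]
  refine (ENat.card_congr (Equiv.ofBijective f ⟨?_, ?_⟩)).symm
  · rintro ⟨⟨u, v⟩, hx⟩ ⟨⟨u', v'⟩, hx'⟩ h
    have hc : (r (u, v)).Congruent (r (u', v')) := Quotient.exact h
    have huv (i : Fin 3) : u i = u' i ∧ v i = v' i := by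
      refine eq_of_sqDist_eq (α := α) (β := β) (by tauto) fun j => ?_
      have := hc (1, i) (0, j)
      simpa [r, Realisation.sqLen_sub] using this
    obtain rfl : u = u' := funext fun i => (huv i).1
    obtain rfl : v = v' := funext fun i => (huv i).2
    rfl
  · intro y
    obtain ⟨⟨q, hq⟩, rfl⟩ := Quotient.exists_rep y
    obtain ⟨h1, h2⟩ := triangularPrism_equivalent_iff.1 hq
    simp only [hα, hβ, hz, hw] at h1 h2
    have hA (i j : Fin 3) : (α i - α j) * (β i - β j) =
        (q.isoZ (0, i) - q.isoZ (0, j)) * (q.isoW (0, i) - q.isoW (0, j)) := by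
      simpa [hα, hβ] using h1 0 i j
    -- Normalise `q` by the isometry carrying its first triangle to `(α, β)`; if it is a reflection,
    -- it swaps the isotropic coordinates of all six vertices.
    suffices H : ∃ u v : Fin 2 × Fin 3 → ℂ, (∀ i, u (0, i) = α i) ∧ (∀ i, v (0, i) = β i) ∧
        ∀ a b, (u a - u b) * (v a - v b) =
          (q.isoZ a - q.isoZ b) * (q.isoW a - q.isoW b) by
      obtain ⟨u, v, hu, hv, huv⟩ := H
      refine ⟨⟨(fun i => u (1, i), fun i => v (1, i)), fun i j => ?_, fun i => ?_⟩, ?_⟩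
      · simp only [huv]
        simpa [hz, hw] using (h1 1 i j).symm
      · have := huv (1, i) (0, i)
        rw [hu, hv] at this
        exact this.trans (h2 i).symm
      · refine Quotient.sound fun a b => ?_
        have e1 : (fun x : Fin 2 × Fin 3 => ![α, fun i => u (1, i)] x.1 x.2) = u := by
          ext ⟨a, i⟩; fin_cases a <;> simp [hu]
        have e2 : (fun x : Fin 2 × Fin 3 => ![β, fun i => v (1, i)] x.1 x.2) = v := by
          ext ⟨a, i⟩; fin_cases a <;> simp [hv]
        simp only [r, Realisation.sqLen_sub, Realisation.isoZ_ofIso, Realisation.isoW_ofIso, e1,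
          e2, huv]
    obtain ⟨x, hx, hrot | hrot⟩ := exists_rotation_of_sides_eq (u := fun i => q.isoZ (0, i))
      (v := fun i => q.isoW (0, i)) (u' := α) (v' := β)
      (by rw [← hA, mul_ne_zero_iff]; tauto) (by rw [← hA, mul_ne_zero_iff]; tauto) hA
    · refine ⟨fun a => α 0 + x * (q.isoZ a - q.isoZ (0, 0)),
        fun a => β 0 + x⁻¹ * (q.isoW a - q.isoW (0, 0)), fun i => ?_, fun i => ?_, fun a b => ?_⟩
      · simp [← (hrot i).1]
      · simp [← (hrot i).2]
      · field_simp; ring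
    · refine ⟨fun a => α 0 + x * (q.isoW a - q.isoW (0, 0)),
        fun a => β 0 + x⁻¹ * (q.isoZ a - q.isoZ (0, 0)), fun i => ?_, fun i => ?_, fun a b => ?_⟩
      · simp [← (hrot i).1]
      · simp [← (hrot i).2]
      · field_simp; ring

/-! ### Generic separability and the count -/

/-- Integer coefficients let the same polynomial map faithfully to `ℂ` and, through the sample `x`,
to `ZMod 7`. -/
theorem separable_gluingPoly_of_generic {φ : MvPolynomial ((Fin 2 × Fin 3) × Fin 2) ℤ →+* ℂ}
    (hφ : Function.Injective φ) {f : Polynomial (MvPolynomial ((Fin 2 × Fin 3) × Fin 2) ℤ)}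
    (hf : f.natDegree ≤ 6) (x : (Fin 2 × Fin 3) × Fin 2 → ℤ) {a : ℤ} (ha : (a : ZMod 7) ≠ 0)
    {g : Polynomial ℤ} (hx : f.map (MvPolynomial.aeval x : _ →ₐ[ℤ] ℤ).toRingHom =
      .C a * (.X ^ 6 - 1) + 7 * g) :
    (f.map φ).Separable ∧ (f.map φ).natDegree = 6 := by
  have : Fact (Nat.Prime 7) := ⟨by norm_num⟩
  obtain ⟨hdeg, hsep⟩ := separable_map_zmod_seven ha hx
  rw [Polynomial.map_map] at hdeg hsep
  have := Polynomial.Separable.of_map_specialization hφ _ (hf.trans hdeg.ge) hsep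
  rwa [hdeg] at this

theorem mainTheorem6 : HasComplexCount triangularPrism 12 := by
  refine ⟨Realisation.exists_isGeneric, fun p hp => ?_⟩
  obtain ⟨φ, hφ, hZ, hW⟩ := hp.exists_injective
  let c (a k : Fin 2) (i : Fin 3) : MvPolynomial ((Fin 2 × Fin 3) × Fin 2) ℤ := .X ((a, i), k)
  let x : (Fin 2 × Fin 3) × Fin 2 → ℤ := fun v =>
    ![![![0, 6, 5], ![0, 4, 2]], ![![0, 6, 4], ![1, 3, 4]]] v.1.1 v.2 v.1.2
  let x' : (Fin 2 × Fin 3) × Fin 2 → ℤ := fun v =>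
    ![![![0, 2, 3], ![0, 1, 3]], ![![0, 6, 3], ![5, 1, 4]]] v.1.1 v.2 v.1.2
  have hx (a k) : (MvPolynomial.aeval x : _ →ₐ[ℤ] ℤ).toRingHom ∘ c a k =
      ![![![0, 6, 5], ![0, 4, 2]], ![![0, 6, 4], ![1, 3, 4]]] a k := by
    ext i; simp [c, x]
  have hx' (a k) : (MvPolynomial.aeval x' : _ →ₐ[ℤ] ℤ).toRingHom ∘ c a k =
      ![![![0, 2, 3], ![0, 1, 3]], ![![0, 6, 3], ![5, 1, 4]]] a k := by
    ext i; simp [c, x']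
  have hnd : nondegeneracy (φ ∘ c 0 0) (φ ∘ c 0 1) (φ ∘ c 1 0) (φ ∘ c 1 1) ≠ 0 := by
    rw [← map_nondegeneracy, map_ne_zero_iff φ hφ]
    intro h
    have := congrArg (MvPolynomial.aeval x : _ →ₐ[ℤ] ℤ).toRingHom h
    rw [map_nondegeneracy, hx, hx, hx, hx, map_zero] at this
    revert this
    simp [nondegeneracy]
  obtain ⟨h1, h1'⟩ := separable_gluingPoly_of_generic hφ
    (natDegree_gluingPoly_le (c 0 0) (c 0 1) (c 1 0) (c 1 1)
      (rungs (c 0 0) (c 0 1) (c 1 0) (c 1 1))) x (a := 5) (by decide) (by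
        rw [map_gluingPoly, map_comp_rungs, hx, hx, hx, hx]; exact gluingPoly_witness)
  obtain ⟨h2, h2'⟩ := separable_gluingPoly_of_generic hφ
    (natDegree_gluingPoly_le (c 0 0) (c 0 1) (c 1 1) (c 1 0)
      (rungs (c 0 0) (c 0 1) (c 1 0) (c 1 1))) x' (a := 2) (by decide) (by
        rw [map_gluingPoly, map_comp_rungs, hx', hx', hx', hx']; exact gluingPoly_swap_witness)
  rw [map_gluingPoly, map_comp_rungs] at h1 h1' h2 h2'
  rw [complexCount_triangularPrism (fun i => (hZ _).symm) (fun i => (hW _).symm)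
    (fun i => (hZ _).symm) (fun i => (hW _).symm) hnd]
  refine (encard_attachments hnd h1 h2).trans ?_
  rw [h1', h2']
  norm_num
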